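/- Conventions. Let $G$ be a group with a finite generating set $S$. The group $G$ with its word metric is regarded as the vertex set of its Cayley graph $X=\mathrm{Cay}(G,S)$, a geodesic metric space in which every edge is isometric to $[0,1]$. A metric space is $\delta$-hyperbolic if $(x,z)_p\ge\min\{(x,y)_p,(y,z)_p\}-\delta$ for all points $p,x,y,z$, where $(x,y)_p=\frac12(|x-p|+|y-p|-|x-y|)$; $G$ is (Gromov) hyperbolic if $X$ is $\delta$-hyperbolic for some $\delta$. $G$ is nonelementary if it is not virtually cyclic, i.e. has no cyclic subgroup of finite index. A geodesic is an isometric embedding of the real line $\mathbb R$ (identified with its image where convenient), $d(p,\gamma)$ is the distance from the point $p$ to $\gamma$, and $d(\gamma',\gamma)=\inf_{x\in\gamma',\,y\in\gamma}|x-y|$. A metric space $X$ is geodesically rich if there are constants $r_0,r_1,r_2,r_3,r_4$ such that (i) for all points $p,q\in X$ with $|p-q|\ge r_0$ there is a geodesic $\gamma$ with $d(p,\gamma)<r_1$ and $\bigl|d(q,\gamma)-|q-p|\bigr|<r_2$; and (ii) for every geodesic $\gamma$ and every point $p\in X$ there is a geodesic $\gamma'$ that passes through the $r_3$-neighborhood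 of $p$ and satisfies $|d(p,\gamma)-d(\gamma',\gamma)|\le r_4$. Theorem. There is a universal constant $C$ such that the following holds for every group $G$ with a finite generating set $S$ for which $X=\mathrm{Cay}(G,S)$ is $\delta$-hyperbolic and $G$ is nonelementary. 1. $X$ is geodesically rich. 2. There are constants $c_1,c_2$ (depending on $G$, $S$ and $\delta$) such that for every point $p\in X$ and every geodesic $\gamma$ in $X$ with $d(p,\gamma)\ge c_1$ there are a geodesic $\gamma'$ and a point $q\in\gamma'$ which minimizes the distance to $\gamma$ up to $C\delta$, that is $d(q,\gamma)\le d(\gamma',\gamma)+C\delta$, and which satisfies $|p-q|\le c_2$. -/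

import Mathlib

open Metric Set

universe u

noncomputable section

namespace GraphRealization

variable {V : Type u} {Γ : SimpleGraph V}

/-- A point on an edge of the graph `Γ`, all edges having length one: the endpoints `fst`, `snd` of
the edge, and the lengths `toFst`, `toSnd` of the two pieces into which the point cuts it.
A degenerate edge, with `fst = snd`, has length zero and is a copy of that vertex. -/
structure EdgePoint (Γ : SimpleGraph V) where
  fst : V
  snd : V
  eq_or_adj : fst = snd ∨ Γ.Adj fst snd
  toFst : ℝ
  toSnd : ℝ
  toFst_nonneg : 0 ≤ toFst
  toSnd_nonneg : 0 ≤ toSnd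
  toFst_add_toSnd : toFst + toSnd = (Γ.dist fst snd : ℝ)

/-- The length of a shortest path between two edge points among those that leave `x` through an
endpoint of its edge, follow edges of the graph, and reach `y` through an endpoint of its edge. -/
def EdgePoint.outerDist (x y : EdgePoint Γ) : ℝ :=
  min
    (min (x.toFst + (Γ.dist x.fst y.fst : ℝ) + y.toFst)
      (x.toFst + (Γ.dist x.fst y.snd : ℝ) + y.toSnd))
    (min (x.toSnd + (Γ.dist x.snd y.fst : ℝ) + y.toFst)
      (x.toSnd + (Γ.dist x.snd y.snd : ℝ) + y.toSnd))

open Classical in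
/-- The path distance between two edge points: measured inside the edge if they lie on the same edge
(written with the same or with the opposite orientation), and through endpoints otherwise. -/
def EdgePoint.pathDist (x y : EdgePoint Γ) : ℝ :=
  if x.fst = y.fst ∧ x.snd = y.snd then |x.toFst - y.toFst|
  else if x.fst = y.snd ∧ x.snd = y.fst then |x.toFst - y.toSnd|
  else x.outerDist y

lemma EdgePoint.cases_pathDist (x y : EdgePoint Γ) :
    (x.fst = y.fst ∧ x.snd = y.snd ∧ x.pathDist y = |x.toFst - y.toFst|) ∨
    (x.fst = y.snd ∧ x.snd = y.fst ∧ x.pathDist y = |x.toFst - y.toSnd|) ∨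
    x.pathDist y = x.outerDist y := by
  unfold EdgePoint.pathDist
  split_ifs <;> tauto

lemma EdgePoint.cases_outerDist (x y : EdgePoint Γ) :
    x.outerDist y = x.toFst + (Γ.dist x.fst y.fst : ℝ) + y.toFst ∨
    x.outerDist y = x.toFst + (Γ.dist x.fst y.snd : ℝ) + y.toSnd ∨
    x.outerDist y = x.toSnd + (Γ.dist x.snd y.fst : ℝ) + y.toFst ∨
    x.outerDist y = x.toSnd + (Γ.dist x.snd y.snd : ℝ) + y.toSnd := by
  unfold EdgePoint.outerDist
  grind

lemma EdgePoint.outerDist_le (x y : EdgePoint Γ) :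
    x.outerDist y ≤ x.toFst + (Γ.dist x.fst y.fst : ℝ) + y.toFst ∧
    x.outerDist y ≤ x.toFst + (Γ.dist x.fst y.snd : ℝ) + y.toSnd ∧
    x.outerDist y ≤ x.toSnd + (Γ.dist x.snd y.fst : ℝ) + y.toFst ∧
    x.outerDist y ≤ x.toSnd + (Γ.dist x.snd y.snd : ℝ) + y.toSnd := by
  unfold EdgePoint.outerDist
  simp only [min_le_iff, le_refl, true_or, or_true, and_self]

lemma EdgePoint.outerDist_comm (x y : EdgePoint Γ) : x.outerDist y = y.outerDist x := by
  have h1 := x.cases_outerDist y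
  have h2 := y.cases_outerDist x
  have h3 := x.outerDist_le y
  have h4 := y.outerDist_le x
  rw [Γ.dist_comm (u := y.fst) (v := x.fst), Γ.dist_comm (u := y.fst) (v := x.snd),
    Γ.dist_comm (u := y.snd) (v := x.fst), Γ.dist_comm (u := y.snd) (v := x.snd)] at h2 h4
  apply le_antisymm
  · rcases h2 with h | h | h | h <;> linarith
  · rcases h1 with h | h | h | h <;> linarith

lemma EdgePoint.pathDist_self (x : EdgePoint Γ) : x.pathDist x = 0 := by
  simp [EdgePoint.pathDist]

lemma EdgePoint.pathDist_comm (x y : EdgePoint Γ) : x.pathDist y = y.pathDist x := by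
  have hx := x.toFst_add_toSnd
  have hy := y.toFst_add_toSnd
  unfold EdgePoint.pathDist
  by_cases h1 : x.fst = y.fst ∧ x.snd = y.snd
  · have h1' : y.fst = x.fst ∧ y.snd = x.snd := ⟨h1.1.symm, h1.2.symm⟩
    rw [if_pos h1, if_pos h1', abs_sub_comm]
  · have h1' : ¬ (y.fst = x.fst ∧ y.snd = x.snd) := fun h => h1 ⟨h.1.symm, h.2.symm⟩
    rw [if_neg h1, if_neg h1']
    by_cases h2 : x.fst = y.snd ∧ x.snd = y.fst
    · have h2' : y.fst = x.snd ∧ y.snd = x.fst := ⟨h2.2.symm, h2.1.symm⟩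
      rw [if_pos h2, if_pos h2']
      rw [h2.1, h2.2, Γ.dist_comm] at hx
      rw [show x.toFst - y.toSnd = y.toFst - x.toSnd by linarith]
    · have h2' : ¬ (y.fst = x.snd ∧ y.snd = x.fst) := fun h => h2 ⟨h.2.symm, h.1.symm⟩
      rw [if_neg h2, if_neg h2', EdgePoint.outerDist_comm]

lemma EdgePoint.pathDist_le_outerDist (x y : EdgePoint Γ) : x.pathDist y ≤ x.outerDist y := by
  have := x.toFst_nonneg
  have := x.toSnd_nonneg
  have := y.toFst_nonneg
  have := y.toSnd_nonneg
  have hx := x.toFst_add_toSnd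
  have hy := y.toFst_add_toSnd
  rcases x.cases_pathDist y with ⟨h1, h2, h⟩ | ⟨h1, h2, h⟩ | h
  · rw [h1, h2] at hx
    have h3 := x.cases_outerDist y
    rw [h1, h2, Γ.dist_comm (u := y.snd) (v := y.fst)] at h3
    simp only [SimpleGraph.dist_self, Nat.cast_zero] at h3
    rw [h, abs_le]
    constructor <;> rcases h3 with h3 | h3 | h3 | h3 <;> linarith
  · rw [h1, h2] at hx
    have h3 := x.cases_outerDist y
    rw [h1, h2] at h3
    rw [Γ.dist_comm (u := y.snd) (v := y.fst)] at h3 hx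
    simp only [SimpleGraph.dist_self, Nat.cast_zero] at h3
    rw [h, abs_le]
    constructor <;> rcases h3 with h3 | h3 | h3 | h3 <;> linarith
  · exact h.le

/-- Moving the first point inside its edge changes the outer distance by at most the move. -/
lemma EdgePoint.outerDist_le_add {x y : EdgePoint Γ} (z : EdgePoint Γ)
    (h : (x.fst = y.fst ∧ x.snd = y.snd ∧ x.pathDist y = |x.toFst - y.toFst|) ∨
      (x.fst = y.snd ∧ x.snd = y.fst ∧ x.pathDist y = |x.toFst - y.toSnd|)) :
    x.outerDist z ≤ x.pathDist y + y.outerDist z := by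
  have hx := x.toFst_add_toSnd
  have hy := y.toFst_add_toSnd
  have h3 := x.outerDist_le z
  have h4 := y.cases_outerDist z
  rcases h with ⟨h1, h2, h⟩ | ⟨h1, h2, h⟩
  · rw [h1, h2] at hx h3
    have h5 := le_abs_self (x.toFst - y.toFst)
    have h6 := neg_abs_le (x.toFst - y.toFst)
    rcases h4 with h4 | h4 | h4 | h4 <;> linarith
  · rw [h1, h2] at hx h3
    rw [Γ.dist_comm] at hx
    have h5 := le_abs_self (x.toFst - y.toSnd)
    have h6 := neg_abs_le (x.toFst - y.toSnd)
    rcases h4 with h4 | h4 | h4 | h4 <;> linarith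

lemma EdgePoint.pathDist_same {x y : EdgePoint Γ} (h1 : x.fst = y.fst) (h2 : x.snd = y.snd) :
    x.pathDist y = |x.toFst - y.toFst| := by
  unfold EdgePoint.pathDist
  rw [if_pos ⟨h1, h2⟩]

lemma EdgePoint.pathDist_opposite {x y : EdgePoint Γ} (h1 : x.fst = y.snd) (h2 : x.snd = y.fst) :
    x.pathDist y = |x.toFst - y.toSnd| := by
  unfold EdgePoint.pathDist
  split_ifs with h
  · have hx := x.toFst_add_toSnd
    have hy := y.toFst_add_toSnd
    have e : y.fst = y.snd := h.1.symm.trans h1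
    rw [h.1, h2, SimpleGraph.dist_self] at hx
    rw [← e, SimpleGraph.dist_self] at hy
    have := x.toFst_nonneg
    have := x.toSnd_nonneg
    have := y.toFst_nonneg
    have := y.toSnd_nonneg
    push_cast at hx hy
    congr 1
    linarith
  · rfl
  · tauto

lemma EdgePoint.pathDist_triangle (hΓ : Γ.Connected) (x y z : EdgePoint Γ) :
    x.pathDist z ≤ x.pathDist y + y.pathDist z := by
  have hx := x.toFst_add_toSnd
  have hy := y.toFst_add_toSnd
  have hz := z.toFst_add_toSnd
  rcases or_assoc.mpr (x.cases_pathDist y) with hxy | hxy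
  · rcases or_assoc.mpr (y.cases_pathDist z) with hyz | hyz
    · rcases hxy with ⟨h1, h2, h⟩ | ⟨h1, h2, h⟩ <;> rcases hyz with ⟨k1, k2, k⟩ | ⟨k1, k2, k⟩
      · rw [EdgePoint.pathDist_same (h1.trans k1) (h2.trans k2), h, k]
        exact abs_sub_le _ _ _
      · rw [EdgePoint.pathDist_opposite (h1.trans k1) (h2.trans k2), h, k]
        exact abs_sub_le _ _ _
      · rw [EdgePoint.pathDist_opposite (h1.trans k2) (h2.trans k1), h, k]
        rw [k1, k2] at hy
        rw [show y.toFst - z.toFst = z.toSnd - y.toSnd by linarith, abs_sub_comm z.toSnd]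
        exact abs_sub_le _ _ _
      · rw [EdgePoint.pathDist_same (h1.trans k2) (h2.trans k1), h, k]
        rw [k1, k2, Γ.dist_comm] at hy
        rw [show y.toFst - z.toSnd = z.toFst - y.toSnd by linarith, abs_sub_comm z.toFst]
        exact abs_sub_le _ _ _
    · have := EdgePoint.outerDist_le_add z hxy
      have := x.pathDist_le_outerDist z
      linarith
  · rcases or_assoc.mpr (z.cases_pathDist y) with hzy | hzy
    · have h1 := EdgePoint.outerDist_le_add x hzy
      have h2 := x.pathDist_le_outerDist z
      rw [EdgePoint.pathDist_comm y z, hxy, EdgePoint.outerDist_comm x y]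
      rw [EdgePoint.outerDist_comm x z] at h2
      linarith
    · rw [EdgePoint.pathDist_comm y z, hxy, hzy, EdgePoint.outerDist_comm z y]
      refine (x.pathDist_le_outerDist z).trans ?_
      have t : ∀ a b c : V, (Γ.dist a c : ℝ) ≤ Γ.dist a b + Γ.dist b c := fun a b c => by
        exact_mod_cast hΓ.dist_triangle
      have e : (Γ.dist y.snd y.fst : ℝ) = Γ.dist y.fst y.snd := by rw [Γ.dist_comm]
      have n1 := y.toFst_nonneg
      have n2 := y.toSnd_nonneg
      have h3 := x.outerDist_le z
      rcases x.cases_outerDist y with h | h | h | h <;>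
      rcases y.cases_outerDist z with k | k | k | k <;>
      rw [h, k]
      · linarith [t x.fst y.fst z.fst]
      · linarith [t x.fst y.fst z.snd]
      · linarith [t x.fst y.fst z.fst, t y.fst y.snd z.fst]
      · linarith [t x.fst y.fst z.snd, t y.fst y.snd z.snd]
      · linarith [t x.fst y.snd z.fst, t y.snd y.fst z.fst]
      · linarith [t x.fst y.snd z.snd, t y.snd y.fst z.snd]
      · linarith [t x.fst y.snd z.fst]
      · linarith [t x.fst y.snd z.snd]
      · linarith [t x.snd y.fst z.fst]
      · linarith [t x.snd y.fst z.snd]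
      · linarith [t x.snd y.fst z.fst, t y.fst y.snd z.fst]
      · linarith [t x.snd y.fst z.snd, t y.fst y.snd z.snd]
      · linarith [t x.snd y.snd z.fst, t y.snd y.fst z.fst]
      · linarith [t x.snd y.snd z.snd, t y.snd y.fst z.snd]
      · linarith [t x.snd y.snd z.fst]
      · linarith [t x.snd y.snd z.snd]

/-- The pseudometric space of edge points of a connected graph. -/
def PreRealization (_hΓ : Γ.Connected) : Type u := EdgePoint Γ

instance instPseudoMetricSpacePreRealization (hΓ : Γ.Connected) :
    PseudoMetricSpace (PreRealization hΓ) where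
  dist x y := EdgePoint.pathDist (Γ := Γ) x y
  dist_self := EdgePoint.pathDist_self
  dist_comm := EdgePoint.pathDist_comm
  dist_triangle := EdgePoint.pathDist_triangle hΓ

end GraphRealization

/-- The geometric realization of a connected graph, a metric space in which every edge is isometric
to the unit interval and distances are lengths of shortest paths. Edge points at distance zero
(the descriptions of one and the same point) are identified. -/
def GraphRealization {V : Type u} {Γ : SimpleGraph V} (hΓ : Γ.Connected) : Type u :=
  SeparationQuotient (GraphRealization.PreRealization hΓ)

instance instMetricSpaceGraphRealization {V : Type u} {Γ : SimpleGraph V} (hΓ : Γ.Connected) :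
    MetricSpace (GraphRealization hΓ) :=
  inferInstanceAs (MetricSpace (SeparationQuotient (GraphRealization.PreRealization hΓ)))

/-- The Cayley graph of a group with respect to a generating set is connected. -/
theorem mulCayley_connected {G : Type u} [Group G] {S : Set G} (hS : Subgroup.closure S = ⊤) :
    (SimpleGraph.mulCayley S).Connected := by
  have key : ∀ s ∈ S, ∀ g : G, (SimpleGraph.mulCayley S).Reachable g (g * s) := by
    intro s hs g
    by_cases h : g = g * s
    · rw [← h]
    · exact SimpleGraph.Adj.reachable
        ((SimpleGraph.mulCayley_adj' S g (g * s)).mpr ⟨h, s, hs, Or.inl rfl⟩)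
  have reach : ∀ x : G, ∀ g : G, (SimpleGraph.mulCayley S).Reachable g (g * x) := by
    intro x
    have hx : x ∈ Subgroup.closure S := by rw [hS]; trivial
    induction hx using Subgroup.closure_induction with
    | mem s hs => exact key s hs
    | one => intro g; rw [mul_one]
    | mul a b _ _ ha hb => intro g; rw [← mul_assoc]; exact (ha g).trans (hb (g * a))
    | inv a _ ha =>
      intro g
      have := ha (g * a⁻¹)
      rw [inv_mul_cancel_right] at this
      exact this.symm
  have : Nonempty G := ⟨1⟩
  refine SimpleGraph.Connected.mk fun g h => ?_
  have := reach (g⁻¹ * h) g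
  rwa [mul_inv_cancel_left] at this

/-- The Cayley graph of a group `G` with respect to a generating set `S`, as a geodesic metric space
that contains `G` with its word metric as the set of vertices. -/
abbrev CayleySpace {G : Type u} [Group G] {S : Set G} (hS : Subgroup.closure S = ⊤) : Type u :=
  GraphRealization (mulCayley_connected hS)

/-- The Gromov product `(x, y)_p`. -/
def gromovProduct {X : Type u} [MetricSpace X] (p x y : X) : ℝ :=
  (dist x p + dist y p - dist x y) / 2

/-- Gromov's four-point condition. -/
def IsGromovHyperbolic (X : Type u) [MetricSpace X] (δ : ℝ) : Prop :=
  ∀ p x y z : X,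
    min (gromovProduct p x y) (gromovProduct p y z) - δ ≤ gromovProduct p x z

/-- A group is elementary if it is virtually cyclic (in particular if it is finite). -/
def IsElementaryGroup (G : Type u) [Group G] : Prop :=
  ∃ H : Subgroup G, IsCyclic H ∧ H.FiniteIndex

/-- The distance between (the images of) two curves. -/
def curveDist {X : Type u} [MetricSpace X] (γ γ' : ℝ → X) : ℝ :=
  ⨅ t : ℝ × ℝ, dist (γ t.1) (γ' t.2)

/-- Geodesically rich metric spaces. A geodesic is an isometric embedding of the real line. -/
def IsGeodesicallyRich (X : Type u) [MetricSpace X] : Prop :=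
  ∃ r₀ r₁ r₂ r₃ r₄ : ℝ,
    (∀ p q : X, r₀ ≤ dist p q →
      ∃ γ : ℝ → X, Isometry γ ∧ infDist p (range γ) < r₁ ∧
        |infDist q (range γ) - dist q p| < r₂) ∧
    (∀ γ : ℝ → X, Isometry γ → ∀ p : X,
      ∃ γ' : ℝ → X, Isometry γ' ∧ infDist p (range γ') < r₃ ∧
        |infDist p (range γ) - curveDist γ' γ| ≤ r₄)

end

/-!
Everything rests on one fact about a hyperbolic group `G` that is not virtually cyclic: there are
constants `R`, `K` such that for all points `p`, `q` of the Cayley graph some geodesic `γ` passes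
within `R` of `p` and satisfies `(γ t, q)_p ≤ K` for all `t`, so that neither end of `γ` points from
`p` towards `q` (`IsGromovHyperbolic.exists_isometry_transverse`).

To prove it one needs three ends of `G` in different directions. An infinite `G` contains a geodesic
line. Two far apart segments of the line are translates of each other, by the pigeonhole principle;
if `G` lay within bounded distance of the line, the translating element would move the whole line
forward, up to a bounded error, and its powers would have finite index
(`isElementaryGroup_of_near_line`). So there are points arbitrarily far from the line; a limit of
shortest segments from these points to the line is a ray that diverges from a line
(`exists_line_and_ray`). By hyperbolicity its Gromov products with the points of the line are
bounded, and hence the end of the ray can be joined to both ends of the line by further lines near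
the identity (`IsGromovHyperbolic.exists_line_joining_rays`). A point `q` has a large Gromov product
with at most one of the three ends, so the line between the other two is transverse to `q`
(`IsGromovHyperbolic.exists_line_transverse`), and homogeneity allows any base point. All limits are
pointwise limits along an ultrafilter, available because balls of the word metric are finite.

Applied to `p` and `q`, the fact gives the first condition of geodesic richness. For a geodesic `γ`
far from `p`, any two points of `γ` have a Gromov product with respect to `p` of about the distance
`D` from `p` to `γ` or more; so a geodesic `γ'` transverse to one point of `γ` is transverse to all
of them, and `dist (γ' s) (γ t) ≥ dist (γ' s) p + D - const`
(`IsGromovHyperbolic.dist_ge_of_transverse`). This gives the second condition, and it also shows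
that the distance to `γ` tends to infinity along `γ'` and has its minimum at a point near `p`
(`IsGromovHyperbolic.exists_nearest_of_transverse`).
-/

/-! ### Vertices and bi-infinite edge paths in the realization of a graph -/

namespace GraphRealization

variable {V : Type u} {Γ : SimpleGraph V}

/-- The point of the realization described by an edge point. -/
noncomputable def mk (hΓ : Γ.Connected) (x : EdgePoint Γ) : GraphRealization hΓ :=
  SeparationQuotient.mk (X := PreRealization hΓ) x

lemma dist_mk (hΓ : Γ.Connected) (x y : EdgePoint Γ) :
    dist (mk hΓ x) (mk hΓ y) = x.pathDist y := rfl

/-- The description of a vertex as a point on a degenerate edge. -/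
def EdgePoint.ofVertex (v : V) : EdgePoint Γ where
  fst := v
  snd := v
  eq_or_adj := Or.inl rfl
  toFst := 0
  toSnd := 0
  toFst_nonneg := le_rfl
  toSnd_nonneg := le_rfl
  toFst_add_toSnd := by simp

/-- A vertex of the graph as a point of the realization. -/
noncomputable def vertex (hΓ : Γ.Connected) (v : V) : GraphRealization hΓ :=
  mk hΓ (EdgePoint.ofVertex v)

lemma dist_vertex (hΓ : Γ.Connected) (v w : V) :
    dist (vertex hΓ v) (vertex hΓ w) = Γ.dist v w := by
  rw [vertex, vertex, dist_mk, EdgePoint.pathDist]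
  by_cases h : v = w
  · simp [EdgePoint.ofVertex, h]
  · simp [EdgePoint.ofVertex, EdgePoint.outerDist, h]

lemma dist_mk_vertex_fst_le (hΓ : Γ.Connected) (x : EdgePoint Γ) :
    dist (mk hΓ x) (vertex hΓ x.fst) ≤ x.toFst := by
  rw [vertex, dist_mk]
  refine (x.pathDist_le_outerDist _).trans ((x.outerDist_le _).1.trans ?_)
  simp [EdgePoint.ofVertex]

lemma exists_dist_vertex_le_one (hΓ : Γ.Connected) (p : GraphRealization hΓ) :
    ∃ v, dist p (vertex hΓ v) ≤ 1 := by
  obtain ⟨x, rfl⟩ : ∃ x, mk hΓ x = p := Quotient.exists_rep p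
  refine ⟨x.fst, (dist_mk_vertex_fst_le hΓ x).trans ?_⟩
  have h1 := x.toFst_add_toSnd
  have h2 := x.toSnd_nonneg
  rcases x.eq_or_adj with h | h
  · rw [h, SimpleGraph.dist_self] at h1
    push_cast at h1
    linarith
  · rw [SimpleGraph.dist_eq_one_iff_adj.mpr h] at h1
    push_cast at h1
    linarith

end GraphRealization

namespace SimpleGraph

/-- The sequence `w` of vertices is, on the set `s` of indices, an isometric embedding into the
vertex set with the graph distance. -/
def IsGeodesicOn {V : Type u} (Γ : SimpleGraph V) (w : ℤ → V) (s : Set ℤ) : Prop :=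
  ∀ i ∈ s, ∀ j ∈ s, (Γ.dist (w i) (w j) : ℤ) = |i - j|

lemma IsGeodesicOn.cast_dist {V : Type u} {Γ : SimpleGraph V} {w : ℤ → V} {s : Set ℤ}
    (h : Γ.IsGeodesicOn w s) {i j : ℤ} (hi : i ∈ s) (hj : j ∈ s) :
    (Γ.dist (w i) (w j) : ℝ) = |(i : ℝ) - j| := by
  exact_mod_cast h i hi j hj

/-- A shortest path, parametrized by arc length from its first endpoint. -/
lemma Connected.exists_isGeodesicOn {V : Type u} {Γ : SimpleGraph V} (hΓ : Γ.Connected) (a b : V) :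
    ∃ w : ℤ → V, w 0 = a ∧ w (Γ.dist a b) = b ∧ Γ.IsGeodesicOn w (Icc 0 (Γ.dist a b)) := by
  obtain ⟨p, hp⟩ := hΓ.exists_walk_length_eq_dist a b
  have step : ∀ n k, Γ.dist (p.getVert n) (p.getVert (n + k)) ≤ k := by
    intro n k
    induction k with
    | zero => simp
    | succ k ih =>
      refine (hΓ.dist_triangle (v := p.getVert (n + k))).trans (add_le_add ih ?_)
      by_cases h : n + k < p.length
      · exact (SimpleGraph.dist_eq_one_iff_adj.mpr (p.adj_getVert_succ h)).le
      · rw [p.getVert_of_length_le (by omega : p.length ≤ n + (k + 1)),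
          p.getVert_of_length_le (by omega : p.length ≤ n + k), SimpleGraph.dist_self]
        exact Nat.zero_le _
  have exact_step : ∀ n k, n + k ≤ p.length →
      Γ.dist (p.getVert n) (p.getVert (n + k)) = k := by
    intro n k hk
    have h1 := step 0 n
    have h2 := step (n + k) (p.length - (n + k))
    rw [zero_add] at h1
    rw [Nat.add_sub_cancel' hk, p.getVert_length] at h2
    rw [p.getVert_zero] at h1
    have h3 : Γ.dist a b ≤ _ := hΓ.dist_triangle (v := p.getVert n)
    have h4 : Γ.dist (p.getVert n) b ≤ _ := hΓ.dist_triangle (v := p.getVert (n + k))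
    have := step n k
    omega
  refine ⟨fun i => p.getVert i.toNat, by simp, by simp [← hp], ?_⟩
  intro i hi j hj
  dsimp only
  rw [← hp] at hi hj
  obtain ⟨hi0, hi1⟩ := hi
  obtain ⟨hj0, hj1⟩ := hj
  rcases le_total i j with h | h
  · obtain ⟨k, rfl⟩ := Int.le.dest h
    have e := exact_step i.toNat k (by omega)
    rw [show (i + k).toNat = i.toNat + k by omega, e]
    simp
  · obtain ⟨k, rfl⟩ := Int.le.dest h
    have e := exact_step j.toNat k (by omega)
    rw [show (j + k).toNat = j.toNat + k by omega, Γ.dist_comm, e]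
    simp

end SimpleGraph

namespace GraphRealization

variable {V : Type u} {Γ : SimpleGraph V}

/-- The point with parameter `t` on the bi-infinite path through the vertices `w n`, traversed at
unit speed: it lies on the edge from `w ⌊t⌋` to `w (⌊t⌋ + 1)`. -/
noncomputable def EdgePoint.onLine {w : ℤ → V} (hw : Γ.IsGeodesicOn w univ) (t : ℝ) :
    EdgePoint Γ where
  fst := w ⌊t⌋
  snd := w (⌊t⌋ + 1)
  eq_or_adj := Or.inr (SimpleGraph.dist_eq_one_iff_adj.mp (by
    have := hw ⌊t⌋ trivial (⌊t⌋ + 1) trivial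
    simpa using this))
  toFst := Int.fract t
  toSnd := 1 - Int.fract t
  toFst_nonneg := Int.fract_nonneg t
  toSnd_nonneg := by linarith [Int.fract_lt_one t]
  toFst_add_toSnd := by
    rw [hw.cast_dist trivial trivial]
    simp

/-- A bi-infinite geodesic path of vertices extends to a geodesic of the realization. -/
lemma exists_isometry_of_isGeodesicOn (hΓ : Γ.Connected) {w : ℤ → V}
    (hw : Γ.IsGeodesicOn w univ) :
    ∃ γ : ℝ → GraphRealization hΓ, Isometry γ ∧ ∀ t, dist (γ t) (vertex hΓ (w ⌊t⌋)) ≤ 1 := by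
  refine ⟨fun t => mk hΓ (EdgePoint.onLine hw t), ?_, fun t =>
    (dist_mk_vertex_fst_le hΓ _).trans (Int.fract_lt_one t).le⟩
  have key : ∀ s t : ℝ, s ≤ t →
      dist (mk hΓ (EdgePoint.onLine hw s)) (mk hΓ (EdgePoint.onLine hw t)) = |s - t| := by
    intro s t hst
    have hs := Int.floor_add_fract s
    have ht := Int.floor_add_fract t
    rcases (Int.floor_le_floor hst).eq_or_lt with h | h
    · rw [dist_mk, EdgePoint.pathDist_same (by simp [EdgePoint.onLine, h])
        (by simp [EdgePoint.onLine, h])]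
      simp only [EdgePoint.onLine]
      have h' : (⌊s⌋ : ℝ) = ⌊t⌋ := by exact_mod_cast h
      congr 1
      linarith
    · have inj : ∀ i j, w i = w j → i = j := by
        intro i j hij
        have := hw i trivial j trivial
        rw [hij, SimpleGraph.dist_self] at this
        have := abs_eq_zero.mp this.symm
        omega
      have h' : (⌊s⌋ : ℝ) + 1 ≤ ⌊t⌋ := by exact_mod_cast h
      have e : ∀ i j : ℤ, i ≤ j → (Γ.dist (w i) (w j) : ℝ) = j - i := by
        intro i j hij
        have : (i : ℝ) ≤ j := by exact_mod_cast hij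
        rw [hw.cast_dist trivial trivial, abs_sub_comm, abs_of_nonneg (by linarith)]
      rw [dist_mk, EdgePoint.pathDist, if_neg, if_neg, EdgePoint.outerDist]
      · simp only [EdgePoint.onLine]
        rw [e _ _ h.le, e ⌊s⌋ (⌊t⌋ + 1) (by omega), e (⌊s⌋ + 1) ⌊t⌋ (by omega),
          e (⌊s⌋ + 1) (⌊t⌋ + 1) (by omega), abs_sub_comm, abs_of_nonneg (by linarith)]
        push_cast
        have f1 := Int.fract_nonneg s
        have f2 := Int.fract_lt_one s
        have f3 := Int.fract_nonneg t
        have f4 := Int.fract_lt_one t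
        rw [min_eq_left (by linarith : Int.fract s + ((⌊t⌋ : ℝ) - ⌊s⌋) + Int.fract t ≤ _),
          min_eq_left (by linarith : 1 - Int.fract s + ((⌊t⌋ : ℝ) - (⌊s⌋ + 1)) + Int.fract t ≤ _),
          min_eq_right (by linarith)]
        linarith
      · rintro ⟨h1, h2⟩
        have := inj _ _ h1
        have := inj _ _ h2
        omega
      · rintro ⟨h1, -⟩
        have := inj _ _ h1
        omega
  refine Isometry.of_dist_eq fun s t => ?_
  rcases le_total s t with h | h
  · rw [key s t h, Real.dist_eq]
  · rw [dist_comm, key t s h, Real.dist_eq, abs_sub_comm]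

end GraphRealization

/-! ### The word metric -/

section Cayley

variable {G : Type u} [Group G] {S : Set G}

lemma mulCayley_dist_mul_left (hS : Subgroup.closure S = ⊤) (g a b : G) :
    (SimpleGraph.mulCayley S).dist (g * a) (g * b) = (SimpleGraph.mulCayley S).dist a b := by
  have le : ∀ g a b : G,
      (SimpleGraph.mulCayley S).dist (g * a) (g * b) ≤ (SimpleGraph.mulCayley S).dist a b := by
    intro g a b
    obtain ⟨p, hp⟩ := (mulCayley_connected hS).exists_walk_length_eq_dist a b
    let f : SimpleGraph.mulCayley S →g SimpleGraph.mulCayley S :=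
      ⟨fun x => g * x, fun {x y} h => by
        rw [SimpleGraph.mulCayley_adj'] at h ⊢
        simpa [mul_assoc] using h⟩
    rw [← hp, ← p.length_map f]
    exact SimpleGraph.dist_le _
  refine le_antisymm (le g a b) ?_
  simpa using le g⁻¹ (g * a) (g * b)

lemma finite_setOf_mulCayley_dist_le (hfin : S.Finite) (hS : Subgroup.closure S = ⊤) (g : G)
    (n : ℕ) : {h | (SimpleGraph.mulCayley S).dist g h ≤ n}.Finite := by
  induction n with
  | zero =>
    refine (finite_singleton g).subset fun h hh => ?_
    exact ((mulCayley_connected hS).dist_eq_zero_iff.mp (Nat.le_zero.mp hh)).symm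
  | succ n ih =>
    refine ((ih.union (ih.image2 (fun a s => a * s) hfin)).union
      (ih.image2 (fun a s => a * s⁻¹) hfin)).subset fun h (hh : _ ≤ n + 1) => ?_
    obtain ⟨w, w0, w1, hw⟩ := (mulCayley_connected hS).exists_isGeodesicOn g h
    rcases Nat.lt_or_ge n ((SimpleGraph.mulCayley S).dist g h) with hn | hn
    · have e : (SimpleGraph.mulCayley S).dist g h = n + 1 := by omega
      rw [e] at w1 hw
      push_cast at w1 hw
      have h1 := hw 0 ⟨le_rfl, by omega⟩ n ⟨by omega, by omega⟩
      have h2 := hw n ⟨by omega, by omega⟩ (n + 1) ⟨by omega, by omega⟩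
      rw [w1] at h2
      rw [w0] at h1
      have h1' : (SimpleGraph.mulCayley S).dist g (w n) ≤ n := by
        rw [zero_sub, abs_neg, Nat.abs_cast] at h1
        omega
      have h2' : (SimpleGraph.mulCayley S).dist (w n) h = 1 := by
        simpa using h2
      obtain ⟨-, s, hs, h3 | h3⟩ := (SimpleGraph.mulCayley_adj' S _ _).mp
        (SimpleGraph.dist_eq_one_iff_adj.mp h2')
      · exact Or.inl (Or.inr ⟨w n, h1', s, hs, h3⟩)
      · exact Or.inr ⟨w n, h1', s, hs, by simp [h3]⟩
    · exact Or.inl (Or.inl hn)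

lemma SimpleGraph.IsGeodesicOn.mul_left (hS : Subgroup.closure S = ⊤) {w : ℤ → G} {s : Set ℤ}
    (hw : (SimpleGraph.mulCayley S).IsGeodesicOn w s) (g : G) :
    (SimpleGraph.mulCayley S).IsGeodesicOn (fun i => g * w i) s := by
  intro i hi j hj
  rw [mulCayley_dist_mul_left hS]
  exact hw i hi j hj

lemma SimpleGraph.IsGeodesicOn.comp_add {V : Type u} {Γ : SimpleGraph V} {w : ℤ → V} {s t : Set ℤ}
    (hw : Γ.IsGeodesicOn w s) (n : ℤ) (h : ∀ i ∈ t, n + i ∈ s) :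
    Γ.IsGeodesicOn (fun i => w (n + i)) t := by
  intro i hi j hj
  rw [hw _ (h i hi) _ (h j hj)]
  ring_nf

end Cayley

/-- Pointwise limits along an ultrafilter, for families of sequences each of whose terms takes
finitely many values. Every property that involves finitely many terms passes to the limit. -/
lemma exists_hyperfilter_limit {ι V : Type*} (w : ℕ → ι → V) (F : ι → Set V)
    (hF : ∀ i, (F i).Finite) (h : ∀ i, ∀ᶠ N in Filter.atTop, w N i ∈ F i) :
    ∃ w' : ι → V, ∀ i, ∀ᶠ N in (Filter.hyperfilter ℕ : Filter ℕ), w N i = w' i := by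
  have : ∀ i, ∃ x, ∀ᶠ N in (Filter.hyperfilter ℕ : Filter ℕ), w N i = x := by
    intro i
    have h1 : ∀ᶠ N in (Filter.hyperfilter ℕ : Filter ℕ), w N i ∈ F i :=
      Nat.hyperfilter_le_atTop (h i)
    have h2 : (⋃ x ∈ F i, {N | w N i = x}) ∈ Filter.hyperfilter ℕ := by
      filter_upwards [h1] with N hN
      simpa using hN
    obtain ⟨x, -, hx⟩ := (Ultrafilter.finite_biUnion_mem_iff (hF i)).mp h2
    exact ⟨x, hx⟩
  choose w' hw' using this
  exact ⟨w', hw'⟩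

/-! ### Groups that lie near a geodesic line are virtually cyclic -/

section Lines

variable {G : Type u} [Group G] {S : Set G}

lemma Subgroup.finiteIndex_of_finite_cover (H : Subgroup G) {F : Set G} (hF : F.Finite)
    (h : ∀ g, ∃ z ∈ H, z⁻¹ * g ∈ F) : H.FiniteIndex := by
  have : Finite F := hF.to_subtype
  have : Finite (G ⧸ H) := by
    refine Finite.of_surjective (fun f : F => QuotientGroup.mk (f : G)⁻¹) fun x => ?_
    induction x using QuotientGroup.induction_on with
    | H g =>
      obtain ⟨z, hz, hf⟩ := h g⁻¹
      refine ⟨⟨_, hf⟩, QuotientGroup.eq.mpr ?_⟩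
      simpa using hz
  exact H.finiteIndex_of_finite_quotient

/-- If every element of the group lies within `D` of a geodesic line, then some left translation
moves the line forward by an arbitrarily large amount, up to an error `2 * D`. By the pigeonhole
principle two far apart segments of length `D + 1` are translates of each other; the orientation
and the position of the translated line are determined by the segment that they share. -/
lemma exists_coarse_translation (hfin : S.Finite) (hS : Subgroup.closure S = ⊤) {v : ℤ → G}
    (hv : (SimpleGraph.mulCayley S).IsGeodesicOn v univ) {D : ℕ}
    (hD : ∀ g, ∃ n, (SimpleGraph.mulCayley S).dist g (v n) ≤ D) (N : ℕ) :
    ∃ (g : G) (k : ℤ), N < k ∧ ∀ i, (SimpleGraph.mulCayley S).dist (g * v i) (v (i + k)) ≤ 2 * D := by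
  set d := (SimpleGraph.mulCayley S).dist with hd
  have tri : ∀ a b c, d a c ≤ d a b + d b c := fun a b c => (mulCayley_connected hS).dist_triangle
  have comm : ∀ a b, d a b = d b a := fun a b => (SimpleGraph.mulCayley S).dist_comm
  have linv : ∀ g a b, d (g * a) (g * b) = d a b := mulCayley_dist_mul_left hS
  have geo : ∀ i j, (d (v i) (v j) : ℤ) = |i - j| := fun i j => hv i trivial j trivial
  let f : ℕ → ℤ := fun a => (N + 1) * a
  obtain ⟨a, b, hab, heq⟩ := Set.Finite.exists_lt_map_eq_of_forall_mem
    (f := fun a : ℕ => (v (f a))⁻¹ * v (f a + (D + 1)))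
    (t := {h | d 1 h ≤ D + 1})
    (fun a => by
      change d 1 _ ≤ D + 1
      rw [← linv (v (f a)), mul_one, mul_inv_cancel_left]
      have := geo (f a) (f a + (D + 1))
      rw [show f a - (f a + (D + 1)) = -((D : ℤ) + 1) by ring, abs_neg, abs_of_nonneg (by omega)]
        at this
      omega)
    (finite_setOf_mulCayley_dist_le hfin hS 1 (D + 1))
  have hk : (N : ℤ) < f b - f a := by
    have : (a : ℤ) + 1 ≤ b := by exact_mod_cast hab
    have : (N + 1 : ℤ) * (a + 1) ≤ (N + 1) * b := by gcongr
    simp only [f]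
    linarith
  set m := f a
  set n := f b
  refine ⟨v n * (v m)⁻¹, n - m, hk, fun i => ?_⟩
  set g := v n * (v m)⁻¹ with hg
  have g0 : g * v m = v n := by simp [hg]
  have g1 : g * v (m + (D + 1)) = v (n + (D + 1)) := by
    have := congrArg (fun x => v n * x) heq
    simpa [hg, mul_assoc] using this
  obtain ⟨c, hc⟩ := hD (g * v i)
  -- The distances to the two endpoints of the common segment almost determine `c`.
  have a1 : d (g * v i) (v n) = d (v i) (v m) := by rw [← g0, linv]
  have a2 : d (g * v i) (v (n + (D + 1))) = d (v i) (v (m + (D + 1))) := by rw [← g1, linv]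
  have b1 := tri (g * v i) (v c) (v n)
  have b2 := tri (v c) (g * v i) (v n)
  have b3 := tri (g * v i) (v c) (v (n + (D + 1)))
  have b4 := tri (v c) (g * v i) (v (n + (D + 1)))
  have b5 := tri (g * v i) (v c) (v (i + (n - m)))
  have e1 := geo i m
  have e2 := geo i (m + (D + 1))
  have e3 := geo c n
  have e4 := geo c (n + (D + 1))
  have e5 := geo c (i + (n - m))
  rw [comm (v c) (g * v i)] at b2 b4
  have : |c - (i + (n - m))| ≤ D := by
    grind
  omega

/-- A finitely generated group that lies within bounded distance of a geodesic line is virtually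
cyclic. -/
theorem isElementaryGroup_of_near_line (hfin : S.Finite) (hS : Subgroup.closure S = ⊤)
    {v : ℤ → G} (hv : (SimpleGraph.mulCayley S).IsGeodesicOn v univ) {D : ℕ}
    (hD : ∀ g, ∃ n, (SimpleGraph.mulCayley S).dist g (v n) ≤ D) : IsElementaryGroup G := by
  obtain ⟨g, k, hk, hg⟩ := exists_coarse_translation hfin hS hv hD (4 * D)
  set d := (SimpleGraph.mulCayley S).dist with hd
  have tri : ∀ a b c, d a c ≤ d a b + d b c := fun a b c => (mulCayley_connected hS).dist_triangle
  have comm : ∀ a b, d a b = d b a := fun a b => (SimpleGraph.mulCayley S).dist_comm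
  have linv : ∀ g a b, d (g * a) (g * b) = d a b := mulCayley_dist_mul_left hS
  have geo : ∀ i j, (d (v i) (v j) : ℤ) = |i - j| := fun i j => hv i trivial j trivial
  choose p hp using hD
  let c : ℤ → ℤ := fun j => p (g ^ j)
  have step : ∀ j, |c (j + 1) - (c j + k)| ≤ 4 * D := by
    intro j
    have h1 : d (g ^ (j + 1)) (v (c (j + 1))) ≤ D := hp _
    have h2 : d (g ^ (j + 1)) (g * v (c j)) ≤ D := by
      rw [add_comm, zpow_add, zpow_one, linv]
      exact hp _
    have h3 := hg (c j)
    have h4 := tri (v (c (j + 1))) (g ^ (j + 1)) (v (c j + k))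
    have h5 := tri (g ^ (j + 1)) (g * v (c j)) (v (c j + k))
    rw [comm] at h1
    have := geo (c (j + 1)) (c j + k)
    omega
  have lower : ∀ j : ℕ, c 0 + j ≤ c j ∧ c (-j) ≤ c 0 - j := by
    intro j
    induction j with
    | zero => simp
    | succ j ih =>
      have h1 := abs_le.mp (step j)
      have h2 := abs_le.mp (step (-(j + 1)))
      rw [show -((j : ℤ) + 1) + 1 = -j by ring] at h2
      push_cast
      omega
  set R : ℕ := 2 * D + (k + 4 * D).toNat with hR
  refine ⟨Subgroup.zpowers g, inferInstance, Subgroup.finiteIndex_of_finite_cover _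
    (finite_setOf_mulCayley_dist_le hfin hS 1 R) fun h => ?_⟩
  obtain ⟨j, hj1, hj2⟩ := Int.exists_greatest_of_bdd (P := fun j => c j ≤ p h)
    ⟨(p h - c 0).natAbs, fun z hz => by
      by_contra hlt
      have := (lower z.toNat).1
      rw [Int.toNat_of_nonneg (by omega)] at this
      omega⟩
    ⟨-(p h - c 0).natAbs, by
      have := (lower (p h - c 0).natAbs).2
      omega⟩
  refine ⟨g ^ j, Subgroup.zpow_mem_zpowers g j, ?_⟩
  change d 1 _ ≤ R
  rw [← linv (g ^ j), mul_one, mul_inv_cancel_left]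
  have h1 : d (g ^ j) (v (c j)) ≤ D := hp _
  have h2 : d h (v (p h)) ≤ D := hp _
  have h3 := tri (g ^ j) (v (c j)) h
  have h4 := tri (v (c j)) (v (p h)) h
  have h5 := geo (c j) (p h)
  have h6 : p h < c (j + 1) := by
    by_contra hlt
    have := hj2 (j + 1) (by omega)
    omega
  have h7 := abs_le.mp (step j)
  rw [comm] at h2
  rw [abs_sub_comm, abs_of_nonneg (by omega)] at h5
  omega

/-! ### A line and a ray that diverge -/

/-- A pointwise limit of geodesics along the ultrafilter is a geodesic. -/
lemma SimpleGraph.IsGeodesicOn.of_eventually {V : Type u} {Γ : SimpleGraph V} {w : ℕ → ℤ → V}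
    {w' : ℤ → V} {s : Set ℤ}
    (hlim : ∀ i, ∀ᶠ N in (Filter.hyperfilter ℕ : Filter ℕ), w N i = w' i)
    (h : ∀ i ∈ s, ∀ j ∈ s, ∀ᶠ N in Filter.atTop, (Γ.dist (w N i) (w N j) : ℤ) = |i - j|) :
    Γ.IsGeodesicOn w' s := by
  intro i hi j hj
  obtain ⟨N, h1, h2, h3⟩ :=
    ((hlim i).and ((hlim j).and (Nat.hyperfilter_le_atTop (h i hi j hj)))).exists
  rw [← h1, ← h2, h3]

/-- An infinite finitely generated group contains a geodesic line: a limit of ever longer geodesic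
segments, translated so that their midpoints lie at the identity. -/
lemma exists_isGeodesicOn_univ (hfin : S.Finite) (hS : Subgroup.closure S = ⊤)
    (hG : ¬ IsElementaryGroup G) :
    ∃ v : ℤ → G, (SimpleGraph.mulCayley S).IsGeodesicOn v univ := by
  set d := (SimpleGraph.mulCayley S).dist with hd
  have far : ∀ N : ℕ, ∃ g, 2 * N ≤ d 1 g := by
    intro N
    by_contra! h
    have : Finite G := Set.finite_univ_iff.mp
      ((finite_setOf_mulCayley_dist_le hfin hS 1 (2 * N)).subset fun g _ => (h g).le)
    exact hG ⟨⊥, inferInstance, inferInstance⟩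
  choose x hx using far
  choose u hu0 hu1 hu using fun N => (mulCayley_connected hS).exists_isGeodesicOn 1 (x N)
  let w : ℕ → ℤ → G := fun N i => (u N N)⁻¹ * u N (N + i)
  have hw : ∀ N : ℕ, (SimpleGraph.mulCayley S).IsGeodesicOn (w N) (Icc (-N) N) := fun N =>
    ((hu N).comp_add N fun i hi => by
      have : ((2 * N : ℕ) : ℤ) ≤ (d 1 (x N) : ℤ) := by exact_mod_cast hx N
      push_cast at this
      exact ⟨by linarith [hi.1], by linarith [hi.2]⟩).mul_left hS _
  have mem : ∀ i : ℤ, ∀ N : ℕ, i.natAbs ≤ N → i ∈ Icc (-(N : ℤ)) N := fun i N h =>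
    ⟨by omega, by omega⟩
  obtain ⟨v, hv⟩ := exists_hyperfilter_limit w (fun i => {h | d 1 h ≤ i.natAbs})
    (fun i => finite_setOf_mulCayley_dist_le hfin hS 1 _) fun i => by
      filter_upwards [Filter.eventually_ge_atTop i.natAbs] with N hN
      have h := hw N 0 (mem _ _ (by simp)) i (mem _ _ hN)
      rw [show w N 0 = 1 by simp [w], zero_sub, abs_neg, Int.abs_eq_natAbs] at h
      exact (Int.ofNat_inj.mp h).le
  refine ⟨v, .of_eventually hv fun i _ j _ => ?_⟩
  filter_upwards [Filter.eventually_ge_atTop i.natAbs, Filter.eventually_ge_atTop j.natAbs]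
    with N h1 h2
  exact hw N i (mem _ _ h1) j (mem _ _ h2)

/-- In a group that is not virtually cyclic there are a geodesic line and a geodesic ray, both
based at the identity, such that the ray realizes the distance of its points to the line. They arise
as a limit of shortest segments to a fixed line from points that are ever farther from it. -/
lemma exists_line_and_ray (hfin : S.Finite) (hS : Subgroup.closure S = ⊤)
    (hG : ¬ IsElementaryGroup G) :
    ∃ v ρ : ℤ → G, (SimpleGraph.mulCayley S).IsGeodesicOn v univ ∧
      (SimpleGraph.mulCayley S).IsGeodesicOn ρ (Ici 0) ∧ v 0 = 1 ∧ ρ 0 = 1 ∧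
      ∀ m, 0 ≤ m → ∀ n, m ≤ (SimpleGraph.mulCayley S).dist (ρ m) (v n) := by
  obtain ⟨v, hv⟩ := exists_isGeodesicOn_univ hfin hS hG
  set d := (SimpleGraph.mulCayley S).dist with hd
  have tri : ∀ a b c, d a c ≤ d a b + d b c := fun a b c => (mulCayley_connected hS).dist_triangle
  have comm : ∀ a b, d a b = d b a := fun a b => (SimpleGraph.mulCayley S).dist_comm
  have linv : ∀ g a b, d (g * a) (g * b) = d a b := mulCayley_dist_mul_left hS
  have far : ∀ N : ℕ, ∃ g, ∀ n, N < d g (v n) := by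
    intro N
    by_contra! h
    exact hG (isElementaryGroup_of_near_line hfin hS hv h)
  choose x hx using far
  have near : ∀ N, ∃ n, ∀ m, d (x N) (v n) ≤ d (x N) (v m) := fun N =>
    ⟨Function.argmin fun n => d (x N) (v n), fun m => Function.argmin_le (fun n => d (x N) (v n)) m⟩
  choose n hn using near
  choose u hu0 hu1 hu using fun N =>
    (mulCayley_connected hS).exists_isGeodesicOn (v (n N)) (x N)
  have long : ∀ N : ℕ, N < d (v (n N)) (x N) := fun N => by
    rw [comm]
    exact hx N _
  let w : ℕ → ℤ → G := fun N i => (v (n N))⁻¹ * v (n N + i)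
  have hw : ∀ N : ℕ, (SimpleGraph.mulCayley S).IsGeodesicOn (w N) univ := fun N =>
    (hv.comp_add _ fun i _ => trivial).mul_left hS _
  -- The ray is only of interest at nonnegative times; elsewhere it is extended by the identity.
  let r : ℕ → ℤ → G := fun N i => (v (n N))⁻¹ * u N (max i 0)
  have hr : ∀ N : ℕ, (SimpleGraph.mulCayley S).IsGeodesicOn (r N) (Icc 0 N) := by
    intro N i hi j hj
    have := long N
    simp only [r]
    rw [mulCayley_dist_mul_left hS, max_eq_left hi.1, max_eq_left hj.1]
    exact hu N i ⟨hi.1, by linarith [hi.2]⟩ j ⟨hj.1, by linarith [hj.2]⟩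
  have hr0 : ∀ N, r N 0 = 1 := fun N => by simp [r, hu0]
  have hw0 : ∀ N, w N 0 = 1 := fun N => by simp [w]
  have apart : ∀ N : ℕ, ∀ m ∈ Icc (0 : ℤ) N, ∀ j, m ≤ d (r N m) (w N j) := by
    intro N m hm j
    have h0 := long N
    simp only [r, w]
    rw [linv, max_eq_left hm.1]
    have h1 := hu N m ⟨hm.1, by linarith [hm.2]⟩ (d (v (n N)) (x N)) ⟨by omega, le_rfl⟩
    rw [hu1, abs_sub_comm, abs_of_nonneg (by linarith [hm.2])] at h1
    have h2 := hn N (n N + j)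
    have h3 := tri (x N) (u N m) (v (n N + j))
    rw [comm (x N), comm (x N) (u N m)] at h3
    rw [comm (x N), comm (x N)] at h2
    change (d (u N m) (x N) : ℤ) = _ at h1
    rw [comm (v (n N + j))] at h2 h3
    omega
  obtain ⟨v', hv'⟩ := exists_hyperfilter_limit w (fun i => {h | d 1 h ≤ i.natAbs})
    (fun i => finite_setOf_mulCayley_dist_le hfin hS 1 _) fun i => by
      refine Filter.Eventually.of_forall fun N => ?_
      have h := hw N 0 trivial i trivial
      rw [hw0, zero_sub, abs_neg, Int.abs_eq_natAbs] at h
      exact (Int.ofNat_inj.mp h).le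
  obtain ⟨ρ, hρ⟩ := exists_hyperfilter_limit r (fun i => {h | d 1 h ≤ i.natAbs})
    (fun i => finite_setOf_mulCayley_dist_le hfin hS 1 _) fun i => by
      filter_upwards [Filter.eventually_ge_atTop i.natAbs] with N hN
      rcases le_total 0 i with hi | hi
      · have h := hr N 0 ⟨le_rfl, by omega⟩ i ⟨hi, by omega⟩
        rw [hr0, zero_sub, abs_neg, Int.abs_eq_natAbs] at h
        exact (Int.ofNat_inj.mp h).le
      · have : r N i = 1 := by rw [← hr0 N]; simp [r, hi]
        simp [this, hd]
  refine ⟨v', ρ, .of_eventually hv' fun i _ j _ => .of_forall fun N => hw N i trivial j trivial,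
    .of_eventually hρ fun i hi j hj => ?_, ?_, ?_, fun m hm j => ?_⟩
  · filter_upwards [Filter.eventually_ge_atTop i.natAbs, Filter.eventually_ge_atTop j.natAbs]
      with N h1 h2
    have hi : 0 ≤ i := hi
    have hj : 0 ≤ j := hj
    exact hr N i ⟨hi, by omega⟩ j ⟨hj, by omega⟩
  · obtain ⟨N, h⟩ := (hv' 0).exists
    rw [← h, hw0]
  · obtain ⟨N, h⟩ := (hρ 0).exists
    rw [← h, hr0]
  · obtain ⟨N, h1, h2, h3⟩ := ((hv' j).and ((hρ m).and
      (Nat.hyperfilter_le_atTop (Filter.eventually_ge_atTop m.natAbs)))).exists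
    rw [← h1, ← h2]
    have h3 : m.natAbs ≤ N := h3
    exact apart N m ⟨hm, by omega⟩ j

end Lines

/-! ### Gromov products -/

section Hyperbolic

variable {X : Type u} [MetricSpace X]

lemma gromovProduct_comm (p x y : X) : gromovProduct p x y = gromovProduct p y x := by
  simp only [gromovProduct, dist_comm x y]
  ring

lemma gromovProduct_nonneg (p x y : X) : 0 ≤ gromovProduct p x y := by
  have := dist_triangle_right x y p
  simp only [gromovProduct]
  linarith

lemma gromovProduct_le_left (p x y : X) : gromovProduct p x y ≤ dist x p := by
  have := dist_triangle_left y p x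
  simp only [gromovProduct]
  linarith

lemma gromovProduct_le_add_base (p p' x y : X) :
    gromovProduct p x y ≤ gromovProduct p' x y + dist p p' := by
  have h1 := dist_triangle_right x p p'
  have h2 := dist_triangle_right y p p'
  simp only [gromovProduct]
  linarith

lemma gromovProduct_le_add_left (p x x' y : X) :
    gromovProduct p x y ≤ gromovProduct p x' y + dist x x' := by
  have h1 := dist_triangle x x' p
  have h2 := dist_triangle_left x' y x
  simp only [gromovProduct]
  linarith

/-- The Gromov product increases along a geodesic that starts at the base point. -/
lemma gromovProduct_le_of_between {p z x : X} (h : dist p z + dist z x = dist p x) (q : X) :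
    gromovProduct p z q ≤ gromovProduct p x q := by
  have h1 := dist_triangle_left x q z
  rw [dist_comm p z, dist_comm p x] at h
  simp only [gromovProduct]
  linarith

variable {δ : ℝ}

lemma IsGromovHyperbolic.nonneg (hX : IsGromovHyperbolic X δ) (p : X) : 0 ≤ δ := by
  simpa [gromovProduct] using hX p p p p

lemma IsGromovHyperbolic.le_of_lt (hX : IsGromovHyperbolic X δ) {p x y z : X} {a : ℝ}
    (h1 : gromovProduct p x z ≤ a) (h2 : a + δ < gromovProduct p x y) :
    gromovProduct p y z ≤ a + δ := by
  rcases min_le_iff.mp (sub_le_iff_le_add.mp ((hX p x y z).trans h1)) with h | h <;> linarith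

/-- The internal point of the side `[x, y]` of a triangle with third vertex `p` is at distance about
`(x, y)_p` from `p`. -/
lemma IsGromovHyperbolic.dist_le_of_between (hX : IsGromovHyperbolic X δ) {p x y z : X} {ε : ℝ}
    (hz : dist x z + dist z y = dist x y)
    (hε : |dist x z - (dist x p - gromovProduct p x y)| ≤ ε) :
    dist z p ≤ gromovProduct p x y + 2 * δ + ε := by
  obtain ⟨h1, h2⟩ := abs_le.mp hε
  have h := sub_le_iff_le_add.mp (hX p x z y)
  simp only [gromovProduct] at *
  rcases min_le_iff.mp h with h | h <;> linarith

/-- Two points of a geodesic far from `p` have a large Gromov product with respect to `p`. -/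
lemma IsGromovHyperbolic.infDist_le_gromovProduct (hX : IsGromovHyperbolic X δ) {γ : ℝ → X}
    (hγ : Isometry γ) (p : X) (s t : ℝ) :
    infDist p (range γ) - 2 * δ ≤ gromovProduct p (γ s) (γ t) := by
  wlog hst : s ≤ t generalizing s t
  · rw [gromovProduct_comm]
    exact this t s (le_of_not_ge hst)
  have len : ∀ a b, a ≤ b → dist (γ a) (γ b) = b - a := fun a b hab => by
    rw [hγ.dist_eq, dist_comm, Real.dist_eq, abs_of_nonneg (by linarith)]
  have h1 := gromovProduct_le_left p (γ s) (γ t)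
  have h2 : dist (γ s) p - gromovProduct p (γ s) (γ t) ≤ t - s := by
    have h4 := dist_triangle (γ s) (γ t) p
    have h5 := dist_triangle_left (γ s) p (γ t)
    have h7 := len s t hst
    rw [dist_comm (γ t) (γ s)] at h5
    simp only [gromovProduct]
    linarith
  set z := s + (dist (γ s) p - gromovProduct p (γ s) (γ t)) with hz
  have hsz : s ≤ z := by linarith
  have hzt : z ≤ t := by linarith
  have h4 := hX.dist_le_of_between (p := p) (x := γ s) (y := γ t) (z := γ z) (ε := 0)
    (by rw [len s z hsz, len z t hzt, len s t hst]; ring)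
    (by rw [len s z hsz, hz, add_sub_cancel_left, sub_self, abs_zero])
  have h5 := infDist_le_dist_of_mem (x := p) (mem_range_self (f := γ) z)
  rw [dist_comm] at h5
  linarith

end Hyperbolic

/-! ### Lines transverse to a given direction -/

section Cayley

variable {G : Type u} [Group G] {S : Set G}

open GraphRealization
open SimpleGraph (mulCayley)

lemma SimpleGraph.IsGeodesicOn.dist_vertex {V : Type u} {Γ : SimpleGraph V} (hΓ : Γ.Connected)
    {w : ℤ → V} {s : Set ℤ} (hw : Γ.IsGeodesicOn w s) {i j : ℤ} (hi : i ∈ s) (hj : j ∈ s)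
    (hij : i ≤ j) : Dist.dist (vertex hΓ (w i)) (vertex hΓ (w j)) = j - i := by
  have : (i : ℝ) ≤ j := by exact_mod_cast hij
  rw [GraphRealization.dist_vertex, hw.cast_dist hi hj, abs_sub_comm, abs_of_nonneg (by linarith)]

/-- Two rays from a common point that diverge at least at unit speed have bounded Gromov
products. -/
lemma IsGromovHyperbolic.gromovProduct_le_of_rays {V : Type u} {Γ : SimpleGraph V}
    {hΓ : Γ.Connected} {δ : ℝ} (hX : IsGromovHyperbolic (GraphRealization hΓ) δ) {a b : ℤ → V}
    (ha : Γ.IsGeodesicOn a (Ici 0)) (hb : Γ.IsGeodesicOn b (Ici 0)) (hab : a 0 = b 0)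
    (h : ∀ m, 0 ≤ m → m ≤ (Γ.dist (a m) (b m) : ℤ)) {m n : ℤ} (hm : 0 ≤ m) (hn : 0 ≤ n) :
    gromovProduct (vertex hΓ (a 0)) (vertex hΓ (a m)) (vertex hΓ (b n)) ≤ 4 * δ + 1 := by
  set o := vertex hΓ (a 0) with ho
  set t := gromovProduct o (vertex hΓ (a m)) (vertex hΓ (b n)) with ht
  have dist_a : ∀ i, 0 ≤ i → dist (vertex hΓ (a i)) o = i := by
    intro i hi
    rw [dist_comm, ha.dist_vertex hΓ self_mem_Ici hi hi]
    simp
  have dist_b : ∀ i, 0 ≤ i → dist (vertex hΓ (b i)) o = i := by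
    intro i hi
    rw [dist_comm, ho, hab, hb.dist_vertex hΓ self_mem_Ici hi hi]
    simp
  have tm : t ≤ m := (gromovProduct_le_left _ _ _).trans_eq (dist_a m hm)
  have tn : t ≤ n := by
    rw [ht, gromovProduct_comm]
    exact (gromovProduct_le_left _ _ _).trans_eq (dist_b n hn)
  have t0 : 0 ≤ t := gromovProduct_nonneg _ _ _
  set s := ⌊t⌋ with hs
  have s0 : 0 ≤ s := Int.floor_nonneg.mpr t0
  have st : (s : ℝ) ≤ t := Int.floor_le t
  have st' : t < s + 1 := Int.lt_floor_add_one t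
  have sm : s ≤ m := by exact_mod_cast st.trans tm
  have sn : s ≤ n := by exact_mod_cast st.trans tn
  have p1 : gromovProduct o (vertex hΓ (a s)) (vertex hΓ (a m)) = s := by
    rw [gromovProduct, dist_a s s0, dist_a m hm, ha.dist_vertex hΓ s0 hm sm]
    ring
  have p2 : gromovProduct o (vertex hΓ (b n)) (vertex hΓ (b s)) = s := by
    rw [gromovProduct_comm, gromovProduct, dist_b s s0, dist_b n hn, hb.dist_vertex hΓ s0 hn sn]
    ring
  have d0 : (s : ℝ) ≤ dist (vertex hΓ (a s)) (vertex hΓ (b s)) := by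
    rw [GraphRealization.dist_vertex]
    exact_mod_cast h s s0
  have q1 := hX o (vertex hΓ (a s)) (vertex hΓ (a m)) (vertex hΓ (b n))
  have q2 := hX o (vertex hΓ (a s)) (vertex hΓ (b n)) (vertex hΓ (b s))
  rw [p1, ← ht, min_eq_left st] at q1
  rw [p2] at q2
  have q3 : s - δ - δ ≤ gromovProduct o (vertex hΓ (a s)) (vertex hΓ (b s)) := by
    refine le_trans (sub_le_sub_right (le_min q1 ?_) δ) q2
    have := hX.nonneg o
    linarith
  rw [gromovProduct, dist_a s s0, dist_b s s0] at q3
  linarith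

/-- Two rays with bounded Gromov products are joined by a line, which passes near their common
origin; a point that has small Gromov product with both rays has small Gromov product with the
line. The line is a limit of geodesic segments from `b N` to `a N`. -/
lemma IsGromovHyperbolic.exists_line_joining_rays (hfin : S.Finite)
    {hS : Subgroup.closure S = ⊤} {δ : ℝ} (hX : IsGromovHyperbolic (CayleySpace hS) δ)
    {a b : ℤ → G} (ha : (mulCayley S).IsGeodesicOn a (Ici 0))
    (hb : (mulCayley S).IsGeodesicOn b (Ici 0)) (ha0 : a 0 = 1) (hb0 : b 0 = 1) {K : ℝ}
    (hK : ∀ m n, 0 ≤ m → 0 ≤ n → gromovProduct (vertex (mulCayley_connected hS) 1)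
      (vertex (mulCayley_connected hS) (a m)) (vertex (mulCayley_connected hS) (b n)) ≤ K) :
    ∃ w : ℤ → G, (mulCayley S).IsGeodesicOn w univ ∧
      dist (vertex (mulCayley_connected hS) (w 0)) (vertex (mulCayley_connected hS) 1)
        ≤ K + 2 * δ + 1 ∧
      ∀ (q : CayleySpace hS) (M : ℝ),
        (∀ m, 0 ≤ m → gromovProduct (vertex (mulCayley_connected hS) 1)
          (vertex (mulCayley_connected hS) (a m)) q ≤ M) →
        (∀ m, 0 ≤ m → gromovProduct (vertex (mulCayley_connected hS) 1)
          (vertex (mulCayley_connected hS) (b m)) q ≤ M) →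
        ∀ i, gromovProduct (vertex (mulCayley_connected hS) 1)
          (vertex (mulCayley_connected hS) (w i)) q ≤ M + 2 * (K + 2 * δ + 1) := by
  set vtx := vertex (mulCayley_connected hS) with hvtx
  set R := K + 2 * δ + 1 with hR
  have dist_a : ∀ i : ℤ, 0 ≤ i → dist (vtx (a i)) (vtx 1) = i := by
    intro i hi
    rw [dist_comm, ← ha0, ha.dist_vertex _ self_mem_Ici hi hi]
    simp
  have dist_b : ∀ i : ℤ, 0 ≤ i → dist (vtx (b i)) (vtx 1) = i := by
    intro i hi
    rw [dist_comm, ← hb0, hb.dist_vertex _ self_mem_Ici hi hi]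
    simp
  choose u hu0 hu1 hu using fun N : ℕ =>
    (mulCayley_connected hS).exists_isGeodesicOn (b N) (a N)
  let P : ℕ → ℝ := fun N => gromovProduct (vtx 1) (vtx (b N)) (vtx (a N))
  have PK : ∀ N, P N ≤ K := fun N => by
    simp only [P]
    rw [gromovProduct_comm]
    exact hK N N (by omega) (by omega)
  have PN : ∀ N, P N ≤ N := fun N => by
    refine (gromovProduct_le_left _ _ _).trans_eq ?_
    rw [dist_b N (by omega)]
    simp
  let L : ℕ → ℤ := fun N => (mulCayley S).dist (b N) (a N)
  have hL : ∀ N, (L N : ℝ) = 2 * N - 2 * P N := fun N => by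
    simp only [P, gromovProduct, L]
    rw [dist_a N (by omega), dist_b N (by omega), hvtx, GraphRealization.dist_vertex]
    push_cast
    ring
  -- `u N (j N)` is the internal point of the segment, up to rounding.
  let j : ℕ → ℤ := fun N => ⌊(N : ℝ) - P N⌋
  have j1 : ∀ N : ℕ, (j N : ℝ) ≤ N - P N := fun N => Int.floor_le _
  have j2 : ∀ N : ℕ, (N : ℝ) - P N < j N + 1 := fun N => Int.lt_floor_add_one _
  have j0 : ∀ N, 0 ≤ j N := fun N => Int.floor_nonneg.mpr (sub_nonneg.mpr (PN N))
  have jL : ∀ N, j N ≤ L N := fun N => by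
    have h : (j N : ℝ) ≤ L N := by linarith [hL N, j1 N, PN N]
    exact_mod_cast h
  let w : ℕ → ℤ → G := fun N i => u N (j N + i)
  have hw : ∀ N, (mulCayley S).IsGeodesicOn (w N) (Icc (-j N) (L N - j N)) := fun N =>
    (hu N).comp_add _ fun i hi => ⟨by linarith [hi.1], by linarith [hi.2]⟩
  have w_a : ∀ N, w N (L N - j N) = a N := fun N => by
    simp only [w, add_sub_cancel]
    exact hu1 N
  have w_b : ∀ N, w N (-j N) = b N := fun N => by
    simp only [w, add_neg_cancel]
    exact hu0 N
  have mem : ∀ (i : ℤ) (N : ℕ), ⌈K⌉₊ + 1 + i.natAbs ≤ N → i ∈ Icc (-j N) (L N - j N) := by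
    intro i N h
    have h' : (⌈K⌉₊ : ℝ) + 1 + (i.natAbs : ℝ) ≤ N := by exact_mod_cast h
    have h1 := Nat.le_ceil K
    have h2 : ((i.natAbs : ℤ) : ℝ) < j N + 1 := by
      rw [Int.cast_natCast]
      linarith [j2 N, PK N]
    have h3 : ((i.natAbs : ℤ) : ℝ) ≤ (L N : ℝ) - j N := by
      rw [Int.cast_natCast]
      linarith [j1 N, PK N, hL N]
    have h2' : (i.natAbs : ℤ) < j N + 1 := by exact_mod_cast h2
    have h3' : (i.natAbs : ℤ) ≤ L N - j N := by exact_mod_cast h3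
    constructor <;> omega
  have zero_mem : ∀ N, (0 : ℤ) ∈ Icc (-j N) (L N - j N) := fun N =>
    ⟨by linarith [j0 N], by linarith [jL N]⟩
  have left_mem : ∀ N, -j N ∈ Icc (-j N) (L N - j N) := fun N =>
    ⟨le_rfl, (zero_mem N).1.trans (zero_mem N).2⟩
  have right_mem : ∀ N, L N - j N ∈ Icc (-j N) (L N - j N) := fun N =>
    ⟨(zero_mem N).1.trans (zero_mem N).2, le_rfl⟩
  have near : ∀ N, dist (vtx (w N 0)) (vtx 1) ≤ R := by
    intro N
    have e1 := (hw N).dist_vertex (mulCayley_connected hS) (left_mem N) (zero_mem N)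
      (zero_mem N).1
    have e2 := (hw N).dist_vertex (mulCayley_connected hS) (zero_mem N) (right_mem N)
      (zero_mem N).2
    have e3 := (hw N).dist_vertex (mulCayley_connected hS) (left_mem N) (right_mem N)
      (left_mem N).2
    rw [w_b] at e1 e3
    rw [w_a] at e2 e3
    have := hX.dist_le_of_between (p := vtx 1) (x := vtx (b N)) (y := vtx (a N))
      (z := vtx (w N 0)) (ε := 1) (by rw [e1, e2, e3]; ring) (by
        rw [e1, dist_b N (by omega), abs_le]
        push_cast
        constructor <;> linarith [j1 N, j2 N])
    linarith [PK N]
  obtain ⟨w', hw'⟩ := exists_hyperfilter_limit w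
    (fun i => {h | (mulCayley S).dist 1 h ≤ ⌈R⌉₊ + i.natAbs})
    (fun i => finite_setOf_mulCayley_dist_le hfin hS 1 _) fun i => by
      filter_upwards [Filter.eventually_ge_atTop (⌈K⌉₊ + 1 + i.natAbs)] with N hN
      have h1 : (mulCayley S).dist 1 (w N 0) ≤ ⌈R⌉₊ := by
        have h2 := (near N).trans (Nat.le_ceil R)
        rw [dist_comm, hvtx, GraphRealization.dist_vertex] at h2
        exact_mod_cast h2
      have h2 := hw N 0 (zero_mem N) i (mem i N hN)
      rw [zero_sub, abs_neg, Int.abs_eq_natAbs] at h2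
      have h3 := (mulCayley_connected hS).dist_triangle (u := 1) (v := w N 0) (w := w N i)
      change _ ≤ _
      omega
  refine ⟨w', .of_eventually hw' fun i _ k _ => ?_, ?_, fun q M hqa hqb i => ?_⟩
  · filter_upwards [Filter.eventually_ge_atTop (⌈K⌉₊ + 1 + i.natAbs),
      Filter.eventually_ge_atTop (⌈K⌉₊ + 1 + k.natAbs)] with N h1 h2
    exact hw N i (mem i N h1) k (mem k N h2)
  · obtain ⟨N, h⟩ := (hw' 0).exists
    rw [← h]
    exact near N
  · obtain ⟨N, h1, h2, h3⟩ := ((hw' 0).and ((hw' i).and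
      (Nat.hyperfilter_le_atTop (Filter.eventually_ge_atTop (⌈K⌉₊ + 1 + i.natAbs))))).exists
    have hi := mem i N h3
    rw [← h2]
    have key : ∀ x, dist (vtx (w N 0)) (vtx (w N i)) + dist (vtx (w N i)) x
        = dist (vtx (w N 0)) x → gromovProduct (vtx 1) x q ≤ M →
        gromovProduct (vtx 1) (vtx (w N i)) q ≤ M + 2 * R := by
      intro x hx hM
      have := near N
      have := gromovProduct_le_add_base (vtx 1) (vtx (w N 0)) (vtx (w N i)) q
      have := gromovProduct_le_add_base (vtx (w N 0)) (vtx 1) x q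
      have := gromovProduct_le_of_between hx q
      rw [dist_comm (vtx 1)] at *
      linarith
    rcases le_total 0 i with h | h
    · refine key (vtx (a N)) ?_ (hqa N (by omega))
      rw [← w_a, (hw N).dist_vertex _ (zero_mem N) hi h,
        (hw N).dist_vertex _ hi (right_mem N) hi.2,
        (hw N).dist_vertex _ (zero_mem N) (right_mem N) (zero_mem N).2]
      ring
    · refine key (vtx (b N)) ?_ (hqb N (by omega))
      rw [← w_b, dist_comm, (hw N).dist_vertex _ hi (zero_mem N) h, dist_comm,
        (hw N).dist_vertex _ (left_mem N) hi hi.1, dist_comm,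
        (hw N).dist_vertex _ (left_mem N) (zero_mem N) (zero_mem N).1]
      ring

/-- For every point `q` there is a line near the identity neither of whose ends points towards `q`.
Two ends of a line and the end of a ray that diverges from it are three ends in different
directions; at most one of them points towards `q`, and the line joins the other two. -/
lemma IsGromovHyperbolic.exists_line_transverse (hfin : S.Finite)
    {hS : Subgroup.closure S = ⊤} {δ : ℝ} (hX : IsGromovHyperbolic (CayleySpace hS) δ)
    (hG : ¬ IsElementaryGroup G) :
    ∃ R K : ℝ, ∀ q : CayleySpace hS, ∃ w : ℤ → G, (mulCayley S).IsGeodesicOn w univ ∧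
      dist (vertex (mulCayley_connected hS) (w 0)) (vertex (mulCayley_connected hS) 1) ≤ R ∧
      ∀ i, gromovProduct (vertex (mulCayley_connected hS) 1)
        (vertex (mulCayley_connected hS) (w i)) q ≤ K := by
  obtain ⟨v, ρ, hv, hρ, hv0, hρ0, hvρ⟩ := exists_line_and_ray hfin hS hG
  have hδ : 0 ≤ δ := hX.nonneg (vertex (mulCayley_connected hS) 1)
  have ha : (mulCayley S).IsGeodesicOn v (Ici 0) := fun i _ j _ => hv i trivial j trivial
  have hb : (mulCayley S).IsGeodesicOn (fun i => v (-i)) (Ici 0) := fun i _ j _ => by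
    rw [hv (-i) trivial (-j) trivial, neg_sub_neg, abs_sub_comm]
  have hKa : ∀ m n, 0 ≤ m → 0 ≤ n → gromovProduct (vertex (mulCayley_connected hS) 1)
      (vertex (mulCayley_connected hS) (ρ m)) (vertex (mulCayley_connected hS) (v n))
      ≤ 4 * δ + 1 := by
    intro m n hm hn
    rw [← hρ0]
    exact hX.gromovProduct_le_of_rays hρ ha (by rw [hρ0, hv0]) (fun k hk => hvρ k hk _) hm hn
  have hKb : ∀ m n, 0 ≤ m → 0 ≤ n → gromovProduct (vertex (mulCayley_connected hS) 1)
      (vertex (mulCayley_connected hS) (ρ m)) (vertex (mulCayley_connected hS) (v (-n)))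
      ≤ 4 * δ + 1 := by
    intro m n hm hn
    rw [← hρ0]
    exact hX.gromovProduct_le_of_rays hρ hb (by simp [hρ0, hv0]) (fun k hk => hvρ k hk _) hm hn
  have hKv : ∀ m n, 0 ≤ m → 0 ≤ n → gromovProduct (vertex (mulCayley_connected hS) 1)
      (vertex (mulCayley_connected hS) (v m)) (vertex (mulCayley_connected hS) (v (-n)))
      ≤ 4 * δ + 1 := by
    intro m n hm hn
    rw [gromovProduct, ← hv0, dist_comm (vertex _ (v m)),
      hv.dist_vertex _ trivial trivial hm, hv.dist_vertex _ trivial trivial (neg_nonpos.mpr hn),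
      dist_comm, hv.dist_vertex _ trivial trivial (by omega)]
    push_cast
    linarith
  obtain ⟨w₁, hw₁, hR₁, hq₁⟩ := hX.exists_line_joining_rays hfin hρ ha hρ0 hv0 hKa
  obtain ⟨w₂, hw₂, hR₂, hq₂⟩ := hX.exists_line_joining_rays hfin hρ hb hρ0 (by simp [hv0]) hKb
  set vtx := vertex (mulCayley_connected hS) with hvtx
  refine ⟨4 * δ + 1 + 2 * δ + 1, 4 * δ + 1 + δ + 2 * (4 * δ + 1 + 2 * δ + 1), fun q => ?_⟩
  by_cases h : ∀ n, gromovProduct (vtx 1) (vtx (v n)) q ≤ 4 * δ + 1 + δ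
  · refine ⟨v, hv, ?_, fun i => (h i).trans (by linarith)⟩
    rw [hv0, dist_self]
    linarith
  · push Not at h
    obtain ⟨n, hn⟩ := h
    rcases le_total 0 n with h0 | h0
    · refine ⟨w₂, hw₂, hR₂, hq₂ q _ (fun m hm => ?_) fun m hm => ?_⟩
      · rw [gromovProduct_comm]
        exact hX.le_of_lt (by rw [gromovProduct_comm]; exact hKa m n hm h0) hn
      · rw [gromovProduct_comm]
        exact hX.le_of_lt (hKv n m h0 hm) hn
    · obtain ⟨k, rfl⟩ : ∃ k, n = -k := ⟨-n, by ring⟩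
      refine ⟨w₁, hw₁, hR₁, hq₁ q _ (fun m hm => ?_) fun m hm => ?_⟩
      · rw [gromovProduct_comm]
        exact hX.le_of_lt (by rw [gromovProduct_comm]; exact hKb m k hm (by omega)) hn
      · rw [gromovProduct_comm]
        exact hX.le_of_lt (by rw [gromovProduct_comm]; exact hKv m k hm (by omega)) hn

/-- By homogeneity, every point `p` lies near a geodesic neither of whose ends points, seen from
`p`, towards a given point `q`. -/
theorem IsGromovHyperbolic.exists_isometry_transverse (hfin : S.Finite)
    {hS : Subgroup.closure S = ⊤} {δ : ℝ} (hX : IsGromovHyperbolic (CayleySpace hS) δ)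
    (hG : ¬ IsElementaryGroup G) :
    ∃ R K : ℝ, ∀ p q : CayleySpace hS, ∃ γ : ℝ → CayleySpace hS, Isometry γ ∧
      dist (γ 0) p ≤ R ∧ ∀ t, gromovProduct p (γ t) q ≤ K := by
  obtain ⟨R, K, h⟩ := hX.exists_line_transverse hfin hG
  refine ⟨R + 2, K + 3, fun p q => ?_⟩
  obtain ⟨g, hg⟩ := exists_dist_vertex_le_one (mulCayley_connected hS) p
  obtain ⟨x, hx⟩ := exists_dist_vertex_le_one (mulCayley_connected hS) q
  obtain ⟨w, hw, hw0, hwi⟩ := h (vertex _ (g⁻¹ * x))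
  obtain ⟨γ, hγ, hγw⟩ := exists_isometry_of_isGeodesicOn (mulCayley_connected hS) (hw.mul_left hS g)
  set vtx := vertex (mulCayley_connected hS) with hvtx
  have linv : ∀ a b, dist (vtx (g * a)) (vtx (g * b)) = dist (vtx a) (vtx b) := fun a b => by
    rw [hvtx, GraphRealization.dist_vertex, GraphRealization.dist_vertex,
      mulCayley_dist_mul_left hS]
  refine ⟨γ, hγ, ?_, fun t => ?_⟩
  · have h1 := hγw 0
    rw [Int.floor_zero] at h1
    have h2 := linv (w 0) 1
    rw [mul_one] at h2
    have h3 := dist_triangle4 (γ 0) (vtx (g * w 0)) (vtx g) p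
    rw [dist_comm (vtx g)] at h3
    linarith
  · have h1 := hγw t
    have h2 : gromovProduct (vtx g) (vtx (g * w ⌊t⌋)) (vtx x) ≤ K := by
      have e := hwi ⌊t⌋
      rw [gromovProduct, ← linv, ← linv _ 1, ← linv (w _), mul_inv_cancel_left, mul_one] at e
      exact e
    have h3 := gromovProduct_le_add_base p (vtx g) (γ t) q
    have h4 := gromovProduct_le_add_left (vtx g) (γ t) (vtx (g * w ⌊t⌋)) q
    have h5 := gromovProduct_le_add_left (vtx g) q (vtx x) (vtx (g * w ⌊t⌋))
    rw [gromovProduct_comm _ q, gromovProduct_comm _ (vtx x)] at h5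
    linarith

end Cayley

/-! ### Geodesic richness -/

section Rich

variable {X : Type u} [MetricSpace X] {δ : ℝ}

lemma curveDist_le (γ γ' : ℝ → X) (s t : ℝ) : curveDist γ γ' ≤ dist (γ s) (γ' t) :=
  ciInf_le (f := fun x : ℝ × ℝ => dist (γ x.1) (γ' x.2))
    ⟨0, by rintro _ ⟨x, rfl⟩; exact dist_nonneg⟩ (s, t)

lemma curveDist_nonneg (γ γ' : ℝ → X) : 0 ≤ curveDist γ γ' := le_ciInf fun _ => dist_nonneg

/-- A geodesic transverse, at `p`, to the direction of one point of a distant geodesic `γ` is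
transverse to the direction of every point of `γ`, and diverges from `γ` at unit speed. -/
lemma IsGromovHyperbolic.dist_ge_of_transverse (hX : IsGromovHyperbolic X δ) {γ γ' : ℝ → X}
    (hγ : Isometry γ) {p : X} {K : ℝ} (hK : ∀ t, gromovProduct p (γ' t) (γ 0) ≤ K)
    (hp : K + 3 * δ < infDist p (range γ)) (s t : ℝ) :
    dist (γ' s) p + infDist p (range γ) - 2 * (K + δ) ≤ dist (γ' s) (γ t) := by
  have h1 := hX.infDist_le_gromovProduct hγ p 0 t
  have h2 : gromovProduct p (γ t) (γ' s) ≤ K + δ :=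
    hX.le_of_lt (x := γ 0) (by rw [gromovProduct_comm]; exact hK s) (by linarith)
  have h3 := infDist_le_dist_of_mem (x := p) (mem_range_self (f := γ) t)
  rw [gromovProduct, dist_comm (γ t) (γ' s), dist_comm (γ t) p] at h2
  linarith

theorem IsGromovHyperbolic.isGeodesicallyRich [Nonempty X] (hX : IsGromovHyperbolic X δ) {R K : ℝ}
    (h : ∀ p q : X, ∃ γ : ℝ → X, Isometry γ ∧ dist (γ 0) p ≤ R ∧
      ∀ t, gromovProduct p (γ t) q ≤ K) : IsGeodesicallyRich X := by
  obtain ⟨x⟩ := ‹Nonempty X›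
  have hδ := hX.nonneg (x)
  obtain ⟨η, -, hR, hK⟩ := h x x
  have hR := dist_nonneg.trans hR
  have hK := (gromovProduct_nonneg _ _ _).trans (hK 0)
  have near : ∀ {γ : ℝ → X} {p}, dist (γ 0) p ≤ R → infDist p (range γ) < R + 1 := by
    intro γ p h
    have := infDist_le_dist_of_mem (x := p) (mem_range_self (f := γ) 0)
    rw [dist_comm] at this
    linarith
  refine ⟨0, R + 1, R + 2 * K + 1, R + 1, R + 2 * K + 3 * δ, fun p q _ => ?_, fun γ hγ p => ?_⟩
  · obtain ⟨γ, hγ, h1, h2⟩ := h p q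
    refine ⟨γ, hγ, near h1, abs_lt.mpr ⟨?_, ?_⟩⟩
    · have : dist q p - 2 * K ≤ infDist q (range γ) := by
        refine (le_infDist (range_nonempty γ)).mpr ?_
        rintro _ ⟨t, rfl⟩
        have := h2 t
        rw [gromovProduct, dist_comm _ q] at this
        linarith [dist_nonneg (x := γ t) (y := p)]
      linarith
    · have h3 := infDist_le_dist_of_mem (x := q) (mem_range_self (f := γ) 0)
      have h4 := dist_triangle_right q (γ 0) p
      linarith
  · obtain ⟨γ', hγ', h1, h2⟩ := h p (γ 0)
    refine ⟨γ', hγ', near h1, abs_le.mpr ⟨?_, ?_⟩⟩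
    · have : curveDist γ' γ - R ≤ infDist p (range γ) := by
        refine (le_infDist (range_nonempty γ)).mpr ?_
        rintro _ ⟨t, rfl⟩
        have h3 := curveDist_le γ' γ 0 t
        have h4 := dist_triangle (γ' 0) p (γ t)
        linarith
      linarith
    · rcases le_or_gt (infDist p (range γ)) (K + 3 * δ) with hp | hp
      · linarith [curveDist_nonneg γ' γ]
      · have : infDist p (range γ) - 2 * (K + δ) ≤ curveDist γ' γ := le_ciInf fun x => by
          have := hX.dist_ge_of_transverse hγ h2 hp x.1 x.2
          linarith [dist_nonneg (x := γ' x.1) (y := p)]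
        linarith

/-- Far from `γ`, a geodesic transverse to `γ` diverges from `γ` in both directions, so that it has
a point nearest to `γ`; this point is near `p`. -/
theorem IsGromovHyperbolic.exists_nearest_of_transverse (hX : IsGromovHyperbolic X δ)
    {γ γ' : ℝ → X} (hγ : Isometry γ) (hγ' : Isometry γ') {p : X} {R K : ℝ}
    (hR : dist (γ' 0) p ≤ R) (hK : ∀ t, gromovProduct p (γ' t) (γ 0) ≤ K)
    (hp : K + 3 * δ < infDist p (range γ)) :
    ∃ q ∈ range γ', infDist q (range γ) ≤ curveDist γ' γ ∧ dist p q ≤ R + 2 * (K + δ) := by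
  have far : ∀ s, dist (γ' s) p + infDist p (range γ) - 2 * (K + δ)
      ≤ infDist (γ' s) (range γ) := by
    intro s
    refine (le_infDist (range_nonempty γ)).mpr ?_
    rintro _ ⟨t, rfl⟩
    exact hX.dist_ge_of_transverse hγ hK hp s t
  have cont : Continuous fun s => infDist (γ' s) (range γ) :=
    (continuous_infDist_pt _).comp hγ'.continuous
  have lim : Filter.Tendsto (fun s => infDist (γ' s) (range γ)) (Filter.cocompact ℝ)
      Filter.atTop := by
    refine Filter.tendsto_atTop_mono (fun s => ?_) (Filter.tendsto_atTop_add_const_right _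
      (infDist p (range γ) - 2 * (K + δ) - R) (tendsto_norm_cocompact_atTop (E := ℝ)))
    have h1 : dist (γ' s) (γ' 0) = ‖s‖ := by rw [hγ'.dist_eq, dist_zero_right]
    have h2 := dist_triangle_right (γ' s) (γ' 0) p
    linarith [far s]
  obtain ⟨s, hs⟩ := cont.exists_forall_le lim
  refine ⟨γ' s, mem_range_self s, le_ciInf fun x => (hs x.1).trans
    (infDist_le_dist_of_mem (mem_range_self x.2)), ?_⟩
  have h1 := infDist_le_infDist_add_dist (s := range γ) (x := γ' 0) (y := p)
  have h2 := hs 0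
  have h3 := far s
  rw [dist_comm p]
  linarith

end Rich

theorem mainTheorem5 :
    ∃ C : ℝ, ∀ (G : Type u) [Group G] (S : Set G) (_ : S.Finite)
      (hS : Subgroup.closure S = ⊤) (δ : ℝ),
      IsGromovHyperbolic (CayleySpace hS) δ → ¬ IsElementaryGroup G →
        IsGeodesicallyRich (CayleySpace hS) ∧
        ∃ c₁ c₂ : ℝ, ∀ (p : CayleySpace hS) (γ : ℝ → CayleySpace hS), Isometry γ →
          c₁ ≤ infDist p (range γ) →
          ∃ γ' : ℝ → CayleySpace hS, Isometry γ' ∧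
            ∃ q ∈ range γ', infDist q (range γ) ≤ curveDist γ' γ + C * δ ∧ dist p q ≤ c₂ := by
  -- The nearest point is attained exactly, so no additive error is needed.
  refine ⟨0, fun G _ S hfin hS δ hX hG => ?_⟩
  obtain ⟨R, K, h⟩ := hX.exists_isometry_transverse hfin hG
  have : Nonempty (CayleySpace hS) := ⟨GraphRealization.vertex _ 1⟩
  refine ⟨hX.isGeodesicallyRich h, K + 3 * δ + 1, R + 2 * (K + δ), fun p γ hγ hp => ?_⟩
  obtain ⟨γ', hγ', hR, hK⟩ := h p (γ 0)
  obtain ⟨q, hq, h1, h2⟩ := hX.exists_nearest_of_transverse hγ hγ' hR hK (by linarith)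
  exact ⟨γ', hγ', q, hq, by simpa using h1, h2⟩
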